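/- Let $\mathcal H\neq 0$ and $\mathcal H_1,\dots,\mathcal H_n$ be finite-dimensional complex Hilbert spaces, let $N=\{1,\dots,n\}$, and for $X\subseteq N$ put $\mathcal H_X=\bigotimes_{i\in X}\mathcal H_i$ (so $\mathcal H_\emptyset=\mathbb C$). A \emph{quantum operation} is a completely positive trace preserving linear map, and $\mathcal S(\cdot)$ denotes the set of density operators. A \emph{quantum secret sharing (QSS) scheme} is a quantum operation $W_N$ from $\mathcal H$ to $\mathcal H_N$ for which there is a quantum operation $R$ from $\mathcal H_N$ to $\mathcal H$ with $R(W_N(\rho))=\rho$ for all $\rho\in\mathcal S(\mathcal H)$. For $X\subseteq N$ let $W_X=\operatorname{Tr}_{N\setminus X}\circ W_N$. The set $X$ is \emph{qualified} if there is a quantum operation $R$ from $\mathcal H_X$ to $\mathcal H$ with $R(W_X(\rho))=\rho$ for all $\rho\in\mathcal S(\mathcal H)$, and \emph{forbidden} if there is $\rho_0\in\mathcal S(\mathcal H_X)$ with $W_X(\rho)=\rho_0$ for all $\rho\in\mathcal S(\mathcal H)$. For integers $k,L\ge 0$ the scheme is a \emph{$(k,L,n)$-threshold ramp QSS scheme}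 if, for every $X\subseteq N$, $X$ is forbidden if and only if $|X|\le k-L$, and $X$ is qualified if and only if $|X|\ge k$. It is a \emph{pure state scheme} if $W_N(\rho)$ is a pure state for every pure state $\rho$. Every $(k,L,n)$-threshold ramp QSS scheme satisfies $n\le 2k-L$. If it is moreover a pure state scheme, then $n=2k-L$. -/

import Mathlib

open scoped ComplexOrder CStarAlgebra MatrixOrder Matrix.Norms.L2Operator

/-!
Conventions. A finite-dimensional Hilbert space with a chosen orthonormal basis indexed by a finite
type `d` is `ℂ^d`, and its linear operators are the matrices `Matrix d d ℂ`, a C*-algebra under the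
operator norm, ordered by positive semidefiniteness. The tensor product of the spaces `ℂ^(κ i)`,
`i ∈ I`, has the product basis, which is indexed by `∀ i : I, κ i`.
-/

namespace RampQSS

/-- The density operators on `ℂ^d`: the positive semidefinite operators of trace one. -/
def densityOperators (d : Type*) [Fintype d] : Set (Matrix d d ℂ) :=
  {ρ | ρ.PosSemidef ∧ ρ.trace = 1}

/-- The pure states on `ℂ^d`: the operators `|ψ⟩⟨ψ|` with `ψ` a unit vector. -/
def pureStates (d : Type*) [Fintype d] : Set (Matrix d d ℂ) :=
  {ρ | ∃ ψ : EuclideanSpace ℂ d, ‖ψ‖ = 1 ∧ ρ = Matrix.of fun a b => ψ a * star (ψ b)}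

/-- A quantum operation from `ℂ^d` to `ℂ^e`: a completely positive, trace preserving linear map. -/
structure QuantumOperation (d e : Type*) [Fintype d] [DecidableEq d] [Fintype e]
    [DecidableEq e] extends Matrix d d ℂ →CP Matrix e e ℂ where
  trace_map : ∀ A : Matrix d d ℂ, (toLinearMap A).trace = A.trace

section Channels

variable {d e : Type*} [Fintype d] [DecidableEq d] [Fintype e] [DecidableEq e]

/-- `E` is reversible with respect to `S`: some quantum operation undoes `E` on `S`. -/
def IsReversible (E : Matrix d d ℂ →ₗ[ℂ] Matrix e e ℂ) (S : Set (Matrix d d ℂ)) : Prop :=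
  ∃ R : QuantumOperation e d, ∀ ρ ∈ S, R.toLinearMap (E ρ) = ρ

/-- `E` is vanishing with respect to `S`: it sends all of `S` to one and the same density
operator. -/
def IsVanishing (E : Matrix d d ℂ →ₗ[ℂ] Matrix e e ℂ) (S : Set (Matrix d d ℂ)) : Prop :=
  ∃ ρ₀ ∈ densityOperators e, ∀ ρ ∈ S, E ρ = ρ₀

/-- `E` sends pure states to pure states. -/
def IsPureStateChannel (E : Matrix d d ℂ →ₗ[ℂ] Matrix e e ℂ) : Prop :=
  ∀ ρ ∈ pureStates d, E ρ ∈ pureStates e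

end Channels

section Shares

variable {ι : Type*} [Fintype ι] [DecidableEq ι]
  {κ : ι → Type*} [∀ i, Fintype (κ i)] [∀ i, DecidableEq (κ i)]

/-- The basis index of the whole system whose part in `X` is `a` and whose part in the complement
of `X` is `c`. -/
def glue (X : Finset ι) (a : ∀ i : {i // i ∈ X}, κ i) (c : ∀ i : {i // i ∉ X}, κ i) :
    ∀ i, κ i :=
  fun i => if h : i ∈ X then a ⟨i, h⟩ else c ⟨i, h⟩

/-- The partial trace over the complement of `X`, which maps the operators on the whole system
to the operators on the subsystem of the shares in `X`. -/
def partialTrace (X : Finset ι) :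
    Matrix (∀ i, κ i) (∀ i, κ i) ℂ →ₗ[ℂ]
      Matrix (∀ i : {i // i ∈ X}, κ i) (∀ i : {i // i ∈ X}, κ i) ℂ where
  toFun A := Matrix.of fun a b => ∑ c : (∀ i : {i // i ∉ X}, κ i), A (glue X a c) (glue X b c)
  map_add' A B := by
    ext a b
    simp [Finset.sum_add_distrib]
  map_smul' r A := by
    ext a b
    simp [Finset.mul_sum]

/-- A quantum secret sharing scheme that encodes `ℂ^d` into shares `ℂ^(κ i)`, `i : ι`: a quantum
operation into the composite system of all shares which is reversible on all states. -/
structure QSSScheme (d : Type*) [Fintype d] [DecidableEq d] {ι : Type*} [Fintype ι]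
    [DecidableEq ι] (κ : ι → Type*) [∀ i, Fintype (κ i)] [∀ i, DecidableEq (κ i)] where
  /-- the encoding operation -/
  encoder : QuantumOperation d (∀ i, κ i)
  reversible : IsReversible encoder.toLinearMap (densityOperators d)

namespace QSSScheme

variable {d : Type*} [Fintype d] [DecidableEq d] (W : QSSScheme d κ)

/-- The encoder followed by the partial trace over the shares outside `X`. -/
def reduced (X : Finset ι) :
    Matrix d d ℂ →ₗ[ℂ] Matrix (∀ i : {i // i ∈ X}, κ i) (∀ i : {i // i ∈ X}, κ i) ℂ :=
  partialTrace X ∘ₗ W.encoder.toLinearMap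

/-- `X` is qualified: its shares determine the encoded state. -/
def IsQualified (X : Finset ι) : Prop := IsReversible (W.reduced X) (densityOperators d)

/-- `X` is forbidden: its shares carry no information on the encoded state. -/
def IsForbidden (X : Finset ι) : Prop := IsVanishing (W.reduced X) (densityOperators d)

/-- `W` is a pure state scheme: its encoder is a pure state channel. -/
def IsPureStateScheme : Prop := IsPureStateChannel W.encoder.toLinearMap

/-- `W` is a `(k, L, n)`-threshold ramp scheme, where `n` is the number of shares. The difference
`k - L` is one of integers. -/
def IsThresholdRamp (k L : ℕ) : Prop :=
  (∀ X : Finset ι, W.IsForbidden X ↔ (X.card : ℤ) ≤ (k : ℤ) - (L : ℤ)) ∧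
    (∀ X : Finset ι, W.IsQualified X ↔ k ≤ X.card)

end QSSScheme

end Shares

end RampQSS

set_option linter.unusedSectionVars false

namespace RampQSS

/-! The theorem rests on a duality between what `X` knows and what leaks to `Xᶜ`. By
`IsQualified.isForbidden_compl`, a qualified set has a forbidden complement; for a set of size `k`
this gives `n - k ≤ k - L`. In a pure state scheme `IsForbidden.isQualified_of_compl` gives the
converse, so the complement of a set of size `k - L` is qualified and `n - (k - L) ≥ k`.

Both directions come from the Knill-Laflamme conditions. Cut a Kraus operator of the encoder into
blocks `B c`, with `c` a basis index of the complement of `X`. The blocks are Kraus operators of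
`W.reduced X`, and the traces of `(B c')ᴴ * B c * A` build the entries of `W.reduced Xᶜ A`.
Reversibility on `X` makes all products `(B c')ᴴ * B c` scalar, so these entries depend only on
`A.trace`. If the encoder has a single Kraus operator, the argument runs backwards: constant entries
force scalar products, from which a recovery is built. -/

theorem exists_eq_star_mul_self {A : Type*} [NonUnitalCStarAlgebra A] [PartialOrder A]
    [StarOrderedRing A] {a : A} (ha : 0 ≤ a) : ∃ b, a = star b * b :=
  CStarAlgebra.nonneg_iff_eq_star_mul_self.mp ha

open Matrix

/-! ### Kraus decompositions of quantum operations -/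

section Kraus

variable {d e s : Type*} [Fintype d] [DecidableEq d] [Fintype e] [DecidableEq e] [Fintype s]

/-- The Kraus decomposition of a completely positive map. -/
theorem exists_kraus (f : Matrix d d ℂ →CP Matrix e e ℂ) :
    ∃ K : d × e → Matrix e d ℂ, ∀ A, f.toLinearMap A = ∑ j, K j * A * (K j)ᴴ := by
  classical
  rcases isEmpty_or_nonempty d with hd | ⟨⟨a₀⟩⟩
  · refine ⟨fun _ => 0, fun A => ?_⟩
    rw [Subsingleton.elim A 0]
    simp
  -- `N` has one nonzero row, chosen so that `star N * N` is the matrix of all matrix units; its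
  -- image under `f` is the Choi matrix, which is therefore positive.
  let N : CStarMatrix d d (Matrix d d ℂ) :=
    CStarMatrix.ofMatrix fun a b => if a = a₀ then Matrix.single a₀ b 1 else 0
  have hM : 0 ≤ (star N * N) := star_mul_self_nonneg N
  have hN : ∀ a b, (star N * N) a b = Matrix.single a b 1 := by
    intro a b
    have hN' : ∀ c b, N c b = if c = a₀ then Matrix.single a₀ b 1 else 0 := fun _ _ => rfl
    rw [CStarMatrix.mul_apply, Finset.sum_eq_single a₀]
    · simp [hN', CStarMatrix.star_apply, Matrix.star_eq_conjTranspose]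
    · intro c _ hc
      simp [hN', hc]
    · simp
  obtain ⟨y, hy⟩ := exists_eq_star_mul_self
    (f.map_cstarMatrix_nonneg _ hM)
  have key : ∀ a b, f.toLinearMap (Matrix.single a b 1) = ∑ c, (y c a)ᴴ * y c b := by
    intro a b
    have := congrFun (congrFun hy a) b
    rw [CStarMatrix.mul_apply, CStarMatrix.map_apply, hN] at this
    exact this
  -- The Kraus operators are the conjugated rows of a square root `y` of the Choi matrix.
  refine ⟨fun j => Matrix.of fun i a => star (y j.1 a j.2 i), fun A => ?_⟩
  conv_lhs => rw [Matrix.matrix_eq_sum_single A]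
  have h1 : ∀ a b, Matrix.single a b (A a b) = A a b • Matrix.single a b (1 : ℂ) := by
    intro a b; simp
  simp only [h1, map_sum, map_smul, key]
  ext i k
  simp only [Matrix.sum_apply, Matrix.smul_apply, Matrix.mul_apply, Matrix.conjTranspose_apply,
    Matrix.of_apply, smul_eq_mul, Fintype.sum_prod_type, star_star, Finset.mul_sum,
    Finset.sum_mul]
  calc _ = ∑ a, ∑ c, ∑ b, ∑ l, A a b * (star (y c a l i) * y c b l k) :=
        Finset.sum_congr rfl fun a _ => Finset.sum_comm
    _ = ∑ c, ∑ a, ∑ b, ∑ l, A a b * (star (y c a l i) * y c b l k) := Finset.sum_comm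
    _ = ∑ c, ∑ a, ∑ l, ∑ b, A a b * (star (y c a l i) * y c b l k) :=
        Finset.sum_congr rfl fun c _ => Finset.sum_congr rfl fun a _ => Finset.sum_comm
    _ = ∑ c, ∑ l, ∑ a, ∑ b, A a b * (star (y c a l i) * y c b l k) :=
        Finset.sum_congr rfl fun c _ => Finset.sum_comm
    _ = ∑ c, ∑ l, ∑ b, ∑ a, A a b * (star (y c a l i) * y c b l k) :=
        Finset.sum_congr rfl fun c _ => Finset.sum_congr rfl fun a _ => Finset.sum_comm
    _ = _ := by
        refine Finset.sum_congr rfl fun c _ => Finset.sum_congr rfl fun l _ =>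
          Finset.sum_congr rfl fun b _ => Finset.sum_congr rfl fun a _ => ?_
        ring

/-- The linear map with Kraus operators `K`. -/
def krausMap (K : s → Matrix e d ℂ) : Matrix d d ℂ →ₗ[ℂ] Matrix e e ℂ where
  toFun A := ∑ j, K j * A * (K j)ᴴ
  map_add' A B := by simp [Matrix.mul_add, Matrix.add_mul, Finset.sum_add_distrib]
  map_smul' r A := by simp [Finset.smul_sum]

theorem krausMap_apply (K : s → Matrix e d ℂ) (A : Matrix d d ℂ) :
    krausMap K A = ∑ j, K j * A * (K j)ᴴ := rfl

theorem trace_krausMap (K : s → Matrix e d ℂ) (A : Matrix d d ℂ) :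
    (krausMap K A).trace = ((∑ j, (K j)ᴴ * K j) * A).trace := by
  simp only [krausMap_apply, Matrix.trace_sum, Finset.sum_mul]
  refine Finset.sum_congr rfl fun j _ => ?_
  rw [Matrix.trace_mul_comm, Matrix.mul_assoc]

/-- If `M = star y * y`, the image has entries `∑ j, ∑ t, (y t a * (K j)ᴴ)ᴴ * (y t b * (K j)ᴴ)`,
visibly a sum of squares. -/
theorem krausMap_nonneg (K : s → Matrix e d ℂ) (k : ℕ)
    (M : CStarMatrix (Fin k) (Fin k) (Matrix d d ℂ)) (hM : 0 ≤ M) :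
    0 ≤ M.map (krausMap K) := by
  classical
  rcases isEmpty_or_nonempty e with he | ⟨⟨i₀⟩⟩
  · rw [Subsingleton.elim (M.map (krausMap K)) 0]
  obtain ⟨y, rfl⟩ := exists_eq_star_mul_self hM
  -- The factors `y t b * (K j)ᴴ` are rectangular, so each of their rows `l` is stored in row `i₀`
  -- of a square matrix.
  let Z : s → Fin k → d → CStarMatrix (Fin k) (Fin k) (Matrix e e ℂ) := fun j t l =>
    CStarMatrix.ofMatrix fun t' b =>
      if t' = t then Matrix.of fun i i' => if i = i₀ then (y t b * (K j)ᴴ) l i' else 0 else 0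
  have : (star y * y).map (krausMap K) = ∑ j, ∑ t, ∑ l, star (Z j t l) * Z j t l := by
    have hZ' : ∀ j t l t' b, Z j t l t' b =
        if t' = t then Matrix.of fun i i' => if i = i₀ then (y t b * (K j)ᴴ) l i' else 0 else 0 :=
      fun _ _ _ _ _ => rfl
    have hZ : ∀ j t l a b i i', (star (Z j t l) * Z j t l) a b i i' =
        star ((y t a * (K j)ᴴ) l i) * (y t b * (K j)ᴴ) l i' := by
      intro j t l a b i i'
      rw [CStarMatrix.mul_apply, Finset.sum_eq_single t]
      · rw [CStarMatrix.star_apply, Matrix.star_eq_conjTranspose, Matrix.mul_apply,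
          Finset.sum_eq_single i₀]
        · simp [hZ']
        · intro c _ hc
          simp [hZ', hc]
        · simp
      · intro c _ hc
        simp [hZ', hc]
      · simp
    refine CStarMatrix.ext fun a b => Matrix.ext fun i i' => ?_
    have hsum : (∑ j, ∑ t, ∑ l, star (Z j t l) * Z j t l) a b =
        ∑ j, ∑ t, ∑ l, (star (Z j t l) * Z j t l) a b := by
      have := Matrix.sum_apply (β := s) (α := Matrix e e ℂ) a b Finset.univ
        fun j => ∑ t, ∑ l, star (Z j t l) * Z j t l
      refine this.trans (Finset.sum_congr rfl fun j _ => ?_)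
      refine (Matrix.sum_apply (α := Matrix e e ℂ) a b Finset.univ
        fun t => ∑ l, star (Z j t l) * Z j t l).trans (Finset.sum_congr rfl fun t _ => ?_)
      exact Matrix.sum_apply (α := Matrix e e ℂ) a b Finset.univ
        fun l => star (Z j t l) * Z j t l
    rw [hsum, CStarMatrix.map_apply, CStarMatrix.mul_apply, krausMap_apply]
    simp only [Matrix.sum_apply, hZ]
    refine Finset.sum_congr rfl fun j _ => ?_
    rw [Matrix.mul_sum, Matrix.sum_mul, Matrix.sum_apply]
    refine Finset.sum_congr rfl fun t _ => ?_
    have : K j * (star y a t * y t b) * (K j)ᴴ = (y t a * (K j)ᴴ)ᴴ * (y t b * (K j)ᴴ) := by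
      rw [CStarMatrix.star_apply, Matrix.star_eq_conjTranspose, Matrix.conjTranspose_mul,
        Matrix.conjTranspose_conjTranspose]
      simp only [Matrix.mul_assoc]
    rw [this, Matrix.mul_apply]
    rfl
  rw [this]
  exact Finset.sum_nonneg fun j _ => Finset.sum_nonneg fun t _ => Finset.sum_nonneg fun l _ =>
    star_mul_self_nonneg _

/-- The quantum operation with Kraus operators `K`. -/
def ofKraus (K : s → Matrix e d ℂ) (hK : ∑ j, (K j)ᴴ * K j = 1) : QuantumOperation d e where
  toLinearMap := krausMap K
  map_cstarMatrix_nonneg' := krausMap_nonneg K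
  trace_map A := by rw [trace_krausMap, hK, one_mul]

theorem QuantumOperation.exists_kraus (R : QuantumOperation d e) :
    ∃ K : d × e → Matrix e d ℂ, R.toLinearMap = krausMap K ∧ ∑ j, (K j)ᴴ * K j = 1 := by
  obtain ⟨K, hK⟩ := RampQSS.exists_kraus R.toCompletelyPositiveMap
  have h : R.toLinearMap = krausMap K := LinearMap.ext hK
  refine ⟨K, h, ?_⟩
  rw [Matrix.ext_iff_trace_mul_right]
  intro A
  rw [← trace_krausMap, ← h, R.trace_map, one_mul]

theorem krausMap_posSemidef (K : s → Matrix e d ℂ) {A : Matrix d d ℂ} (hA : A.PosSemidef) :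
    (krausMap K A).PosSemidef :=
  Matrix.posSemidef_sum _ fun j _ => hA.mul_mul_conjTranspose_same (K j)

/-- The Kraus operators of the identity channel are scalars. -/
theorem exists_eq_smul_one_of_krausMap_eq_id [Nonempty d] (K : s → Matrix d d ℂ)
    (h : ∀ A, krausMap K A = A) : ∃ c : s → ℂ, ∀ j, K j = c j • 1 := by
  have key : ∀ a b i k, ∑ j, K j i a * star (K j k b) = Matrix.single a b (1 : ℂ) i k := by
    intro a b i k
    rw [← h (Matrix.single a b 1), krausMap_apply, Matrix.sum_apply]
    refine Finset.sum_congr rfl fun j _ => ?_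
    simp [Matrix.mul_apply, Matrix.single_apply, ite_and]
  have sq : ∀ f : s → ℂ, ∑ j, f j * star (f j) = 0 → ∀ j, f j = 0 := by
    intro f hf j
    have := (Finset.sum_eq_zero_iff_of_nonneg (fun j _ => mul_star_self_nonneg (f j))).1 hf j
      (Finset.mem_univ j)
    simpa using this
  -- Evaluating the channel on matrix units shows that `∑ j, |K j i a|²` and `∑ j, |K j i i - K j a
  -- a|²` vanish, the latter as `1 - 1 - 1 + 1`.
  have off : ∀ j i a, i ≠ a → K j i a = 0 := fun j i a hia =>
    sq (fun j => K j i a) (by rw [key]; simp [hia.symm]) j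
  have diag : ∀ j i a, K j i i = K j a a := fun j i a => by
    refine sub_eq_zero.1 (sq (fun j => K j i i - K j a a) ?_ j)
    simp only [star_sub, sub_mul, mul_sub, Finset.sum_sub_distrib, key]
    simp
  obtain ⟨a₀⟩ := ‹Nonempty d›
  refine ⟨fun j => K j a₀ a₀, fun j => ?_⟩
  ext i a
  by_cases hia : i = a
  · subst hia; simp [diag j i a₀]
  · simp [hia, off j i a hia]

/-- The density operators span all operators. -/
theorem linearMap_ext_densityOperators {M : Type*} [AddCommGroup M] [Module ℂ M]
    {f g : Matrix d d ℂ →ₗ[ℂ] M} (h : ∀ ρ ∈ densityOperators d, f ρ = g ρ) : f = g := by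
  refine LinearMap.ext_on (CStarAlgebra.span_nonneg (A := Matrix d d ℂ)) fun A hA => ?_
  have hA : A.PosSemidef := Matrix.nonneg_iff_posSemidef.1 hA
  by_cases ht : A.trace = 0
  · simp [hA.trace_eq_zero_iff.1 ht]
  · have hd : (A.trace)⁻¹ • A ∈ densityOperators d :=
      ⟨hA.smul (inv_nonneg.2 hA.trace_nonneg), by simp [ht]⟩
    have := h _ hd
    simp only [map_smul] at this
    exact smul_right_injective M (inv_ne_zero ht) this

end Kraus

/-! ### Knill-Laflamme conditions and pure state channels -/

section KnillLaflamme

variable {d e s : Type*} [Fintype d] [DecidableEq d] [Nonempty d] [Fintype e] [DecidableEq e]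
  [Fintype s]

/-- The Knill-Laflamme conditions are necessary for the channel with Kraus operators `T` to be
undone by a quantum operation. -/
theorem exists_conjTranspose_mul_eq_smul_one (T : s → Matrix e d ℂ) (R : QuantumOperation e d)
    (h : ∀ A, R.toLinearMap (krausMap T A) = A) :
    ∃ σ : Matrix s s ℂ, ∀ c c', (T c')ᴴ * T c = σ c c' • 1 := by
  obtain ⟨K, hR, hK⟩ := R.exists_kraus
  -- The products `K r * T c` are Kraus operators of the identity, hence scalars. Inserting `∑ r, (K
  -- r)ᴴ * K r = 1` between `(T c')ᴴ` and `T c` then gives `σ`.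
  obtain ⟨l, hl⟩ := exists_eq_smul_one_of_krausMap_eq_id
    (fun p : (e × d) × s => K p.1 * T p.2) fun A => by
      conv_rhs => rw [← h A, hR]
      simp only [krausMap_apply, Fintype.sum_prod_type (α₂ := s), Matrix.mul_sum, Matrix.sum_mul,
        Matrix.conjTranspose_mul, Matrix.mul_assoc]
  refine ⟨fun c c' => ∑ r, star (l (r, c')) * l (r, c), fun c c' => ?_⟩
  calc (T c')ᴴ * T c = (T c')ᴴ * (∑ r, (K r)ᴴ * K r) * T c := by rw [hK, Matrix.mul_one]
    _ = ∑ r, (K r * T c')ᴴ * (K r * T c) := by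
      simp only [Matrix.mul_sum, Matrix.sum_mul, Matrix.conjTranspose_mul, Matrix.mul_assoc]
    _ = _ := by
      rw [Finset.sum_smul]
      refine Finset.sum_congr rfl fun r _ => ?_
      rw [hl (r, c), hl (r, c')]
      simp [smul_smul, mul_comm]

/-- A channel whose Kraus operators have pairwise orthogonal ranges and are multiples of
isometries is undone by a quantum operation. -/
theorem exists_recovery_of_orthogonal [DecidableEq s] (V : s → Matrix e d ℂ) (p : s → ℝ)
    (hp : ∀ c, 0 ≤ p c) (hp1 : ∑ c, p c = 1)
    (hV : ∀ c c', (V c')ᴴ * V c = if c = c' then (p c : ℂ) • 1 else 0) :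
    ∃ R : QuantumOperation e d, ∀ A, R.toLinearMap (krausMap V A) = A := by
  obtain ⟨a₀⟩ := ‹Nonempty d›
  have hV0 : ∀ c, p c = 0 → V c = 0 := fun c hc => by
    rw [← Matrix.conjTranspose_mul_self_eq_zero, hV]
    simp [hc]
  have hpV : ∀ c, ((p c : ℂ)⁻¹ * p c) • V c = V c := fun c => by
    by_cases hc : p c = 0
    · simp [hV0 c hc]
    · rw [inv_mul_cancel₀ (by exact_mod_cast hc), one_smul]
  -- `P` projects onto the joint range of the `V c`. Where `p c = 0` the convention `0⁻¹ = 0` is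
  -- harmless, as `V c = 0`.
  set P : Matrix e e ℂ := ∑ c, (p c : ℂ)⁻¹ • (V c * (V c)ᴴ) with hP
  have hPV : ∀ c, P * V c = V c := fun c => by
    rw [hP, Matrix.sum_mul, Finset.sum_eq_single c]
    · rw [Matrix.smul_mul, Matrix.mul_assoc, hV, if_pos rfl, Matrix.mul_smul, Matrix.mul_one,
        smul_smul, hpV]
    · intro q _ hq
      rw [Matrix.smul_mul, Matrix.mul_assoc, hV, if_neg hq.symm, Matrix.mul_zero, smul_zero]
    · simp
  have hPP : P * P = P := by
    calc P * P = ∑ c, (p c : ℂ)⁻¹ • (P * V c * (V c)ᴴ) := by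
          conv_lhs => arg 2; rw [hP]
          simp only [Matrix.mul_sum, Matrix.mul_smul, Matrix.mul_assoc]
      _ = P := by simp only [hPV]; exact hP.symm
  have hPH : Pᴴ = P := by
    simp [hP, Matrix.conjTranspose_sum, Matrix.conjTranspose_smul, Matrix.conjTranspose_mul]
  have hQ : (1 - P)ᴴ * (1 - P) = 1 - P := by
    rw [Matrix.conjTranspose_sub, hPH, Matrix.conjTranspose_one]
    simp [mul_sub, sub_mul, hPP]
  have hsqrt : ∀ c, (((√(p c))⁻¹ : ℝ) : ℂ) * (((√(p c))⁻¹ : ℝ) : ℂ) = (p c : ℂ)⁻¹ := fun c => by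
    rw [← Complex.ofReal_mul, ← mul_inv, Real.mul_self_sqrt (hp c), Complex.ofReal_inv]
  -- The first family inverts each rescaled isometry; the second sends the range of `1 - P` to the
  -- basis state `a₀`, only to preserve the trace.
  let K : s ⊕ e → Matrix d e ℂ :=
    Sum.elim (fun c => (((√(p c))⁻¹ : ℝ) : ℂ) • (V c)ᴴ) (fun x => Matrix.single a₀ x (1 : ℂ) * (1 - P))
  have hK : ∑ j, (K j)ᴴ * K j = 1 := by
    rw [Fintype.sum_sum_type]
    have h1 : ∑ c, (K (Sum.inl c))ᴴ * K (Sum.inl c) = P := by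
      refine Finset.sum_congr rfl fun c _ => ?_
      simp only [K, Sum.elim_inl, Matrix.conjTranspose_smul, Matrix.conjTranspose_conjTranspose,
        Matrix.smul_mul, Matrix.mul_smul, smul_smul]
      rw [RCLike.star_def, Complex.conj_ofReal, hsqrt]
    have h2 : ∑ x, (K (Sum.inr x))ᴴ * K (Sum.inr x) = 1 - P := by
      have : ∀ x, (K (Sum.inr x))ᴴ * K (Sum.inr x) =
          (1 - P)ᴴ * (Matrix.single x x (1 : ℂ) * (1 - P)) := fun x => by
        simp only [K, Sum.elim_inr, Matrix.conjTranspose_mul, Matrix.conjTranspose_single]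
        rw [Matrix.mul_assoc, ← Matrix.mul_assoc (Matrix.single x a₀ _)]
        simp
      simp only [this]
      rw [← Matrix.mul_sum, ← Matrix.sum_mul, Matrix.sum_single_one, Matrix.one_mul, hQ]
    rw [h1, h2]
    abel
  have hinl : ∀ q c, K (Sum.inl q) * V c =
      if c = q then ((((√(p q))⁻¹ : ℝ) : ℂ) * (p q : ℂ)) • 1 else 0 := fun q c => by
    simp only [K, Sum.elim_inl, Matrix.smul_mul, hV]
    split_ifs with hcq
    · rw [smul_smul, hcq]
    · simp
  have hinr : ∀ x c, K (Sum.inr x) * V c = 0 := fun x c => by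
    simp only [K, Sum.elim_inr]
    rw [Matrix.mul_assoc, Matrix.sub_mul, hPV, Matrix.one_mul, sub_self, Matrix.mul_zero]
  refine ⟨ofKraus K hK, fun A => ?_⟩
  change krausMap K (krausMap V A) = A
  have hterm : ∀ j c, K j * (V c * A * (V c)ᴴ) * (K j)ᴴ = (K j * V c) * A * (K j * V c)ᴴ := by
    intro j c
    simp only [Matrix.conjTranspose_mul, Matrix.mul_assoc]
  simp only [krausMap_apply, Matrix.mul_sum, Matrix.sum_mul, hterm, Fintype.sum_sum_type, hinr,
    Matrix.zero_mul, Finset.sum_const_zero, add_zero]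
  have hq : ∀ q, ∑ c, K (Sum.inl q) * V c * A * (K (Sum.inl q) * V c)ᴴ = (p q : ℂ) • A := by
    intro q
    rw [Finset.sum_eq_single q]
    · rw [hinl, if_pos rfl, Matrix.smul_mul, Matrix.one_mul, Matrix.conjTranspose_smul,
        Matrix.conjTranspose_one, Matrix.mul_smul, Matrix.mul_one, smul_smul]
      congr 1
      rw [star_mul', RCLike.star_def, Complex.conj_ofReal, Complex.conj_ofReal,
        mul_mul_mul_comm, hsqrt]
      by_cases hc : p q = 0
      · simp [hc]
      · have : (p q : ℂ) ≠ 0 := by exact_mod_cast hc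
        field_simp
    · intro c _ hc
      rw [hinl, if_neg hc, Matrix.zero_mul, Matrix.zero_mul]
    · simp
  simp only [hq]
  rw [← Finset.sum_smul, ← Complex.ofReal_sum, hp1, Complex.ofReal_one, one_smul]

/-- The Knill-Laflamme conditions are sufficient for the channel with Kraus operators `V` to be
undone by a quantum operation. -/
theorem exists_recovery (V : s → Matrix e d ℂ) (hV1 : ∑ c, (V c)ᴴ * V c = 1)
    (σ : Matrix s s ℂ) (hV : ∀ c c', (V c')ᴴ * V c = σ c c' • 1) :
    ∃ R : QuantumOperation e d, ∀ A, R.toLinearMap (krausMap V A) = A := by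
  classical
  obtain ⟨a₀⟩ := id ‹Nonempty d›
  have hinj : ∀ x y : ℂ, x • (1 : Matrix d d ℂ) = y • 1 → x = y := fun x y h => by
    simpa using congrFun (congrFun h a₀) a₀
  have hσ : σ.IsHermitian := by
    ext c c'
    refine hinj _ _ ?_
    rw [← hV, Matrix.conjTranspose_apply, ← Matrix.conjTranspose_conjTranspose ((V c')ᴴ * V c),
      Matrix.conjTranspose_mul, Matrix.conjTranspose_conjTranspose, hV, Matrix.conjTranspose_smul,
      Matrix.conjTranspose_one]
  obtain ⟨U, p, hUU, hUD⟩ : ∃ (U : Matrix s s ℂ) (p : s → ℝ), U * Uᴴ = 1 ∧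
      Uᴴ * σ * U = Matrix.diagonal fun c => (p c : ℂ) := by
    refine ⟨hσ.eigenvectorUnitary, hσ.eigenvalues,
      Unitary.coe_mul_star_self hσ.eigenvectorUnitary, ?_⟩
    have h := hσ.conjStarAlgAut_star_eigenvectorUnitary
    rw [Unitary.conjStarAlgAut_star_apply] at h
    exact h
  -- A unitary mixing of Kraus operators leaves the channel unchanged; the one that diagonalizes `σ`
  -- makes the ranges orthogonal.
  let V' : s → Matrix e d ℂ := fun q => ∑ c, star (U c q) • V c
  have hV' : ∀ q q', (V' q')ᴴ * V' q = if q = q' then (p q : ℂ) • 1 else 0 := fun q q' => by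
    have : (V' q')ᴴ * V' q = (Uᴴ * σ * U) q q' • 1 := by
      simp only [V', Matrix.conjTranspose_sum, Matrix.conjTranspose_smul, star_star,
        Matrix.sum_mul, Matrix.mul_sum, Matrix.smul_mul, Matrix.mul_smul, hV, smul_smul,
        Matrix.mul_apply, Finset.sum_mul, Finset.sum_smul, Finset.smul_sum,
        Matrix.conjTranspose_apply]
      rw [Finset.sum_comm]
      refine Finset.sum_congr rfl fun c' _ => Finset.sum_congr rfl fun c _ => ?_
      congr 1
      ring
    rw [this, hUD, Matrix.diagonal_apply]
    split_ifs <;> simp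
  have hp : ∀ q, 0 ≤ p q := fun q => by
    have h := (Matrix.posSemidef_conjTranspose_mul_self (V' q)).diag_nonneg (i := a₀)
    rw [hV', if_pos rfl] at h
    simpa using h
  have hkraus : ∀ A, krausMap V' A = krausMap V A := fun A => by
    have h : ∀ c' c, ∑ q, (U c' q * star (U c q)) • (V c * A * (V c')ᴴ) =
        (1 : Matrix s s ℂ) c' c • (V c * A * (V c')ᴴ) := fun c' c => by
      rw [← hUU, Matrix.mul_apply, Finset.sum_smul]
      rfl
    calc krausMap V' A = ∑ q, ∑ c', ∑ c, (U c' q * star (U c q)) • (V c * A * (V c')ᴴ) := by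
          simp only [krausMap_apply, V', Matrix.conjTranspose_sum, Matrix.conjTranspose_smul,
            star_star, Matrix.sum_mul, Matrix.mul_sum, Matrix.smul_mul, Matrix.mul_smul,
            Finset.smul_sum, smul_smul]
      _ = ∑ c', ∑ c, (1 : Matrix s s ℂ) c' c • (V c * A * (V c')ᴴ) := by
          rw [Finset.sum_comm]
          refine Finset.sum_congr rfl fun c' _ => ?_
          rw [Finset.sum_comm]
          exact Finset.sum_congr rfl fun c _ => h c' c
      _ = krausMap V A := by
          simp [Matrix.one_apply, krausMap_apply]
  have hp1 : ∑ q, p q = 1 := by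
    have h : ∑ c, σ c c = 1 := by
      refine hinj _ _ ?_
      rw [Finset.sum_smul, one_smul]; refine Eq.trans ?_ hV1
      exact Finset.sum_congr rfl fun c _ => (hV c c).symm
    have h2 := congrArg Matrix.trace hUD
    rw [Matrix.mul_assoc, Matrix.trace_mul_comm, Matrix.mul_assoc, hUU, Matrix.mul_one,
      Matrix.trace_diagonal, Matrix.trace] at h2
    simp only [Matrix.diag_apply, h] at h2
    exact_mod_cast h2.symm
  obtain ⟨R, hR⟩ := exists_recovery_of_orthogonal V' p hp hp1 hV'
  exact ⟨R, fun A => by rw [← hkraus, hR]⟩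

/-- A correctable channel that maps the basis states to pure states has a single Kraus
operator. -/
theorem exists_single_kraus (T : s → Matrix e d ℂ) (hT : ∑ c, (T c)ᴴ * T c = 1)
    (σ : Matrix s s ℂ) (hσ : ∀ c c', (T c')ᴴ * T c = σ c c' • 1)
    (hpure : ∀ a, krausMap T (Matrix.single a a 1) ∈ pureStates e) :
    ∃ V : Matrix e d ℂ, ∀ A, krausMap T A = V * A * Vᴴ := by
  obtain ⟨c₀, hc₀⟩ : ∃ c, σ c c ≠ 0 := by
    by_contra! h
    simp [hσ, h] at hT
  -- Purity of the output on basis state `a` makes column `a` of every `T c` proportional to one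
  -- vector. The ratio to `T c₀` is read from inner products, which `σ` gives independently of `a`;
  -- so whole operators are proportional.
  have hcol : ∀ a c i, T c i a * σ c₀ c₀ = T c₀ i a * σ c c₀ := by
    intro a c i
    obtain ⟨φ, hφ1, hφ⟩ := hpure a
    have hent : ∀ i k, ∑ j, T j i a * star (T j k a) = φ i * star (φ k) := fun i k => by
      have := congrFun (congrFun hφ i) k
      rw [krausMap_apply, Matrix.sum_apply] at this
      rw [Matrix.of_apply] at this
      rw [← this]
      refine Finset.sum_congr rfl fun j _ => ?_
      simp [Matrix.mul_apply, Matrix.single_apply, ite_and]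
    have hminor : ∀ j i k, φ k * T j i a = φ i * T j k a := fun j i k => by
      have h0 : ∑ j, (φ k * T j i a - φ i * T j k a) * star (φ k * T j i a - φ i * T j k a) = 0 := by
        calc _ = φ k * star (φ k) * (∑ j, T j i a * star (T j i a))
              - φ k * star (φ i) * (∑ j, T j i a * star (T j k a))
              - φ i * star (φ k) * (∑ j, T j k a * star (T j i a))
              + φ i * star (φ i) * (∑ j, T j k a * star (T j k a)) := by
              simp only [Finset.mul_sum, ← Finset.sum_sub_distrib, ← Finset.sum_add_distrib]
              refine Finset.sum_congr rfl fun j _ => ?_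
              rw [star_sub, star_mul', star_mul']
              ring
          _ = 0 := by
              simp only [hent]
              ring
      have := (Finset.sum_eq_zero_iff_of_nonneg (fun j _ => mul_star_self_nonneg _)).1 h0 j
        (Finset.mem_univ j)
      exact sub_eq_zero.1 ((mul_eq_zero.1 this).elim id star_eq_zero.1)
    obtain ⟨k, hk⟩ : ∃ k, φ k ≠ 0 := by
      by_contra! h
      have : φ = 0 := by ext k; exact h k
      simp [this] at hφ1
    have hinner : ∀ c, σ c c₀ = ∑ l, star (T c₀ l a) * T c l a := fun c => by
      have := congrFun (congrFun (hσ c c₀) a) a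
      simpa [Matrix.mul_apply] using this.symm
    rw [hinner c₀, hinner c, Finset.mul_sum, Finset.mul_sum]
    refine Finset.sum_congr rfl fun l _ => mul_left_cancel₀ (mul_ne_zero hk hk) ?_
    linear_combination star (T c₀ l a) * (φ k * T c₀ l a * hminor c i k - φ k * T c l a * hminor c₀ i k
      + φ i * T c k a * hminor c₀ l k - φ i * T c₀ k a * hminor c l k)
  have hTc : ∀ c, T c = (σ c c₀ / σ c₀ c₀) • T c₀ := fun c => by
    ext i a
    rw [Matrix.smul_apply, smul_eq_mul, div_mul_eq_mul_div, eq_div_iff hc₀, hcol, mul_comm]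
  set μ : s → ℂ := fun c => σ c c₀ / σ c₀ c₀
  refine ⟨((√(∑ c, Complex.normSq (μ c)) : ℝ) : ℂ) • T c₀, fun A => ?_⟩
  rw [krausMap_apply, Matrix.conjTranspose_smul, Matrix.smul_mul, Matrix.smul_mul, Matrix.mul_smul,
    smul_smul, RCLike.star_def, Complex.conj_ofReal, ← Complex.ofReal_mul, Real.mul_self_sqrt
      (Finset.sum_nonneg fun c _ => Complex.normSq_nonneg _), Complex.ofReal_sum, Finset.sum_smul]
  refine Finset.sum_congr rfl fun c _ => ?_
  rw [hTc c, Matrix.conjTranspose_smul, Matrix.smul_mul, Matrix.smul_mul, Matrix.mul_smul,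
    smul_smul, RCLike.star_def, Complex.mul_conj]

end KnillLaflamme

/-! ### Partial traces in terms of blocks -/

section Shares

variable {ι : Type*} [Fintype ι] [DecidableEq ι]
  {κ : ι → Type*} [∀ i, Fintype (κ i)] [∀ i, DecidableEq (κ i)]
  {d : Type*} [Fintype d] [DecidableEq d]

/-- The block of an operator into the whole system at the basis index `c` of the complement of
`X`. -/
def block (X : Finset ι) (w : Matrix (∀ i, κ i) d ℂ) (c : ∀ i : {i // i ∉ X}, κ i) :
    Matrix (∀ i : {i // i ∈ X}, κ i) d ℂ :=
  w.submatrix (fun a => glue X a c) id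

/-- The basis indices of the complement of `X`, in its two guises. -/
def complEquiv (X : Finset ι) :
    (∀ i : {i // i ∈ Xᶜ}, κ i) ≃ (∀ i : {i // i ∉ X}, κ i) where
  toFun a i := a ⟨i, Finset.mem_compl.2 i.2⟩
  invFun a i := a ⟨i, Finset.mem_compl.1 i.2⟩
  left_inv _ := rfl
  right_inv _ := rfl

/-- The basis indices of `X`, in its two guises. -/
def complComplEquiv (X : Finset ι) :
    (∀ i : {i // i ∈ X}, κ i) ≃ (∀ i : {i // i ∉ Xᶜ}, κ i) where
  toFun a i := a ⟨i, by simpa using i.2⟩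
  invFun a i := a ⟨i, by simp⟩
  left_inv _ := rfl
  right_inv _ := rfl

theorem glue_compl (X : Finset ι) (c : ∀ i : {i // i ∈ Xᶜ}, κ i)
    (a : ∀ i : {i // i ∈ X}, κ i) :
    glue Xᶜ c (complComplEquiv X a) = glue X a (complEquiv X c) := by
  funext i
  by_cases h : i ∈ X <;> simp [glue, h, complEquiv, complComplEquiv]

theorem glue_bijective (X : Finset ι) :
    Function.Bijective fun p : (∀ i : {i // i ∈ X}, κ i) × (∀ i : {i // i ∉ X}, κ i) =>
      glue X p.1 p.2 :=
  (Equiv.piEquivPiSubtypeProd (· ∈ X) κ).symm.bijective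

theorem trace_partialTrace (X : Finset ι) (A : Matrix (∀ i, κ i) (∀ i, κ i) ℂ) :
    (partialTrace X A).trace = A.trace := by
  rw [Matrix.trace, Matrix.trace, ← (glue_bijective X).sum_comp, Fintype.sum_prod_type]
  rfl

theorem partialTrace_posSemidef (X : Finset ι) {A : Matrix (∀ i, κ i) (∀ i, κ i) ℂ}
    (hA : A.PosSemidef) : (partialTrace X A).PosSemidef := by
  have h : partialTrace X A =
      ∑ c : (∀ i : {i // i ∉ X}, κ i), A.submatrix (glue X · c) (glue X · c) := by
    ext a b
    simp [partialTrace, Matrix.sum_apply]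
  rw [h]
  exact Matrix.posSemidef_sum _ fun c _ => hA.submatrix _

theorem partialTrace_krausMap {s : Type*} [Fintype s] (X : Finset ι)
    (K : s → Matrix (∀ i, κ i) d ℂ) (A : Matrix d d ℂ) :
    partialTrace X (krausMap K A) =
      krausMap (fun p : (∀ i : {i // i ∉ X}, κ i) × s => block X (K p.2) p.1) A := by
  ext a b
  simp only [partialTrace, krausMap_apply, LinearMap.coe_mk, AddHom.coe_mk, Matrix.of_apply,
    Fintype.sum_prod_type, Matrix.sum_apply]
  rfl

/-- By cyclicity of the trace, these entries test the products in the Knill-Laflamme conditions for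
`X` against `A`; this links the two complementary subsystems. -/
theorem partialTrace_compl_krausMap {s : Type*} [Fintype s] (X : Finset ι)
    (K : s → Matrix (∀ i, κ i) d ℂ) (A : Matrix d d ℂ) (c c' : ∀ i : {i // i ∈ Xᶜ}, κ i) :
    partialTrace Xᶜ (krausMap K A) c c' =
      ∑ j, (block X (K j) (complEquiv X c) * A *
        (block X (K j) (complEquiv X c'))ᴴ).trace := by
  simp only [partialTrace, krausMap_apply, LinearMap.coe_mk, AddHom.coe_mk, Matrix.of_apply,
    Matrix.trace, Matrix.diag_apply, Matrix.sum_apply]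
  rw [Finset.sum_comm]
  refine Finset.sum_congr rfl fun j _ => ?_
  rw [← (complComplEquiv X).sum_comp]
  simp only [glue_compl]
  rfl

theorem sum_block_conjTranspose_mul_block (X : Finset ι) (w : Matrix (∀ i, κ i) d ℂ) :
    ∑ c, (block X w c)ᴴ * block X w c = wᴴ * w := by
  ext a b
  simp only [Matrix.sum_apply, Matrix.mul_apply]
  rw [← (glue_bijective X).sum_comp, Fintype.sum_prod_type, Finset.sum_comm]
  rfl

/-! ### Qualified and forbidden sets -/

namespace QSSScheme

variable (W : QSSScheme d κ)

theorem encoder_posSemidef {A : Matrix d d ℂ} (hA : A.PosSemidef) :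
    (W.encoder.toLinearMap A).PosSemidef := by
  obtain ⟨K, hK, -⟩ := W.encoder.exists_kraus
  rw [hK]
  exact krausMap_posSemidef K hA

theorem reduced_mem_densityOperators (X : Finset ι) {ρ : Matrix d d ℂ}
    (hρ : ρ ∈ densityOperators d) :
    W.reduced X ρ ∈ densityOperators (∀ i : {i // i ∈ X}, κ i) :=
  ⟨partialTrace_posSemidef X (W.encoder_posSemidef hρ.1),
    (trace_partialTrace X _).trans ((W.encoder.trace_map ρ).trans hρ.2)⟩

theorem single_mem_densityOperators (a : d) :
    Matrix.single a a (1 : ℂ) ∈ densityOperators d := by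
  refine ⟨?_, by simp⟩
  have := Matrix.posSemidef_conjTranspose_mul_self (Matrix.single a a (1 : ℂ))
  simpa using this

variable {W}

theorem IsQualified.exists_recovery {X : Finset ι} (h : W.IsQualified X) :
    ∃ R : QuantumOperation (∀ i : {i // i ∈ X}, κ i) d,
      ∀ A, R.toLinearMap (W.reduced X A) = A := by
  obtain ⟨R, hR⟩ := h
  refine ⟨R, fun A => ?_⟩
  have := linearMap_ext_densityOperators (f := R.toLinearMap ∘ₗ W.reduced X)
    (g := LinearMap.id) hR
  exact LinearMap.congr_fun this A

/-- No cloning: the complement of a qualified set is forbidden. -/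
theorem IsQualified.isForbidden_compl [Nonempty d] {X : Finset ι} (h : W.IsQualified X) :
    W.IsForbidden Xᶜ := by
  obtain ⟨R, hR⟩ := h.exists_recovery
  obtain ⟨K, hK, -⟩ := W.encoder.exists_kraus
  obtain ⟨σ, hσ⟩ := exists_conjTranspose_mul_eq_smul_one _ R fun A => by
    rw [← partialTrace_krausMap X K A, ← hK]
    exact hR A
  -- Only the products of blocks with equal Kraus index `j` enter.
  have key : ∀ A, A.trace = 1 → ∀ c c', W.reduced Xᶜ A c c' =
      ∑ j, σ (complEquiv X c, j) (complEquiv X c', j) := by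
    intro A hA c c'
    change partialTrace Xᶜ (W.encoder.toLinearMap A) c c' = _
    rw [hK, partialTrace_compl_krausMap]
    refine Finset.sum_congr rfl fun j _ => ?_
    rw [Matrix.trace_mul_comm, ← Matrix.mul_assoc, hσ (complEquiv X c, j) (complEquiv X c', j),
      Matrix.smul_mul, Matrix.one_mul, Matrix.trace_smul, hA, smul_eq_mul, mul_one]
  obtain ⟨a⟩ := id ‹Nonempty d›
  have ha := single_mem_densityOperators a
  refine ⟨W.reduced Xᶜ (Matrix.single a a 1), W.reduced_mem_densityOperators _ ha,
    fun ρ hρ => ?_⟩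
  ext c c'
  rw [key ρ hρ.2, key _ ha.2]

variable (W) in
-- Tracing out nothing only relabels the basis along `τ`, so the given recovery applies after
-- reindexing its Kraus operators.
theorem isQualified_univ : W.IsQualified Finset.univ := by
  obtain ⟨R, hR⟩ := W.reversible
  obtain ⟨K, hK, hK1⟩ := R.exists_kraus
  let τ : (∀ i : {i // i ∈ (Finset.univ : Finset ι)}, κ i) ≃ (∀ i, κ i) :=
    { toFun := fun a i => a ⟨i, Finset.mem_univ i⟩
      invFun := fun a i => a i
      left_inv := fun _ => rfl
      right_inv := fun _ => rfl }
  have hτ : ∀ A, partialTrace Finset.univ A = A.submatrix τ τ := by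
    intro A
    ext a b
    have hu : Unique (∀ i : {i // i ∉ (Finset.univ : Finset ι)}, κ i) :=
      { default := fun i => (i.2 (Finset.mem_univ _)).elim
        uniq := fun c => funext fun i => (i.2 (Finset.mem_univ _)).elim }
    have hg : ∀ a c, glue Finset.univ a c = τ a := fun a c => by
      funext i
      simp [glue, τ]
    simp [partialTrace, hg]
  refine ⟨ofKraus (fun j => (K j).submatrix id τ) ?_, fun ρ hρ => ?_⟩
  · have : ∑ j, ((K j)ᴴ * K j).submatrix τ τ = 1 := by
      rw [← Matrix.submatrix_one_equiv τ, ← hK1]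
      ext a b
      simp only [Matrix.sum_apply, Matrix.submatrix_apply]
    exact this
  · change krausMap _ (partialTrace Finset.univ (W.encoder.toLinearMap ρ)) = ρ
    conv_rhs => rw [← hR ρ hρ, hK]
    rw [hτ, krausMap_apply, krausMap_apply]
    refine Finset.sum_congr rfl fun j _ => ?_
    rw [Matrix.conjTranspose_submatrix, Matrix.submatrix_mul_equiv, Matrix.submatrix_mul_equiv,
      Matrix.submatrix_id_id]

/-- In a pure state scheme, the complement of a forbidden set is qualified. -/
theorem IsForbidden.isQualified_of_compl [Nonempty d] (hW : W.IsPureStateScheme) {X : Finset ι}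
    (h : W.IsForbidden Xᶜ) : W.IsQualified X := by
  obtain ⟨K, hK, hK1⟩ := W.encoder.exists_kraus
  -- Purity and reversibility together reduce the encoder to a single operator `V`, which trace
  -- preservation makes an isometry.
  obtain ⟨V, hV⟩ : ∃ V : Matrix (∀ i, κ i) d ℂ,
      W.encoder.toLinearMap = krausMap fun _ : Unit => V := by
    obtain ⟨R, hR⟩ := W.reversible
    have hR' := LinearMap.congr_fun (linearMap_ext_densityOperators
      (f := R.toLinearMap ∘ₗ W.encoder.toLinearMap) (g := LinearMap.id) hR)
    obtain ⟨σ, hσ⟩ := exists_conjTranspose_mul_eq_smul_one K R fun A => by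
      rw [← hK]
      exact hR' A
    obtain ⟨V, hV⟩ := exists_single_kraus K hK1 σ hσ fun a => by
      rw [← hK]
      refine hW _ ⟨EuclideanSpace.single a 1, by simp, ?_⟩
      ext i j
      by_cases hi : a = i <;> by_cases hj : a = j <;>
        simp [Matrix.single_apply, hi, hj, eq_comm]
    exact ⟨V, LinearMap.ext fun A => by rw [hK, hV]; simp [krausMap_apply]⟩
  have hV1 : Vᴴ * V = 1 := by
    rw [Matrix.ext_iff_trace_mul_right]
    intro A
    have := trace_krausMap (fun _ : Unit => V) A
    rw [← hV, W.encoder.trace_map] at this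
    simpa using this.symm
  obtain ⟨ρ₀, -, hρ₀⟩ := h
  have hlin : ∀ A, W.reduced Xᶜ A = A.trace • ρ₀ := by
    have := linearMap_ext_densityOperators (f := W.reduced Xᶜ)
      (g := (Matrix.traceLinearMap d ℂ ℂ).smulRight ρ₀) fun ρ hρ => by
        rw [hρ₀ ρ hρ]
        simp [hρ.2]
    exact fun A => LinearMap.congr_fun this A
  let σ : Matrix (∀ i : {i // i ∉ X}, κ i) (∀ i : {i // i ∉ X}, κ i) ℂ :=
    ρ₀.submatrix (complEquiv X).symm (complEquiv X).symm
  -- Pairing with an arbitrary `A` under the trace gives `σ c c' * A.trace`, which determines the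
  -- product.
  have hσ : ∀ c c', (block X V c')ᴴ * block X V c = σ c c' • 1 := by
    intro c c'
    rw [Matrix.ext_iff_trace_mul_right]
    intro A
    have := congrFun (congrFun (hlin A) ((complEquiv X).symm c)) ((complEquiv X).symm c')
    change partialTrace Xᶜ (W.encoder.toLinearMap A) _ _ = _ at this
    rw [hV, partialTrace_compl_krausMap] at this
    simp only [Equiv.apply_symm_apply, Finset.univ_unique, Finset.sum_singleton] at this
    rw [Matrix.mul_assoc, Matrix.trace_mul_comm, this]
    simp [σ, mul_comm]
  obtain ⟨R, hR⟩ := RampQSS.exists_recovery (block X V)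
    ((sum_block_conjTranspose_mul_block X V).trans hV1) σ hσ
  refine ⟨R, fun ρ _ => ?_⟩
  change R.toLinearMap (partialTrace X (W.encoder.toLinearMap ρ)) = ρ
  conv_rhs => rw [← hR ρ]
  rw [hV, partialTrace_krausMap]
  congr 1
  simp [krausMap_apply, Fintype.sum_prod_type]

end QSSScheme

end Shares

end RampQSS

/-! ### The bounds on the number of shares -/

theorem lemma2 {k L n : ℕ} {d : Type*} [Fintype d] [DecidableEq d] [Nonempty d]
    {κ : Fin n → Type*} [∀ i, Fintype (κ i)] [∀ i, DecidableEq (κ i)]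
    (W : RampQSS.QSSScheme d κ) (hW : W.IsThresholdRamp k L) :
    (n : ℤ) ≤ 2 * (k : ℤ) - (L : ℤ) ∧
      (W.IsPureStateScheme → (n : ℤ) = 2 * (k : ℤ) - (L : ℤ)) := by
  obtain ⟨hF, hQ⟩ := hW
  have hkn : k ≤ n := by
    simpa using (hQ Finset.univ).1 W.isQualified_univ
  -- The empty set, as complement of everything, is forbidden. Hence the natural subtraction `k - L`
  -- below is not truncated.
  have hLk : (L : ℤ) ≤ k := by
    simpa using (hF _).1 W.isQualified_univ.isForbidden_compl
  have hle : (n : ℤ) ≤ 2 * (k : ℤ) - (L : ℤ) := by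
    obtain ⟨X, -, hX⟩ := Finset.exists_subset_card_eq (s := (Finset.univ : Finset (Fin n)))
      (n := k) (by simpa using hkn)
    have h := (hF _).1 ((hQ X).2 hX.ge).isForbidden_compl
    rw [Finset.card_compl, hX, Fintype.card_fin] at h
    omega
  refine ⟨hle, fun hpure => le_antisymm hle ?_⟩
  obtain ⟨Y, -, hY⟩ := Finset.exists_subset_card_eq (s := (Finset.univ : Finset (Fin n)))
    (n := k - L) (by simp; omega)
  have hYF : W.IsForbidden Yᶜᶜ := (hF _).2 (by rw [compl_compl, hY]; omega)
  have h := (hQ _).1 (hYF.isQualified_of_compl hpure)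
  rw [Finset.card_compl, hY, Fintype.card_fin] at h
  omega
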